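/- **Setting.** A polyomino is a finite set $P\subset\mathbb Z^2$ of cells (tiles) whose induced grid graph is connected. It is *$x$-monotone* if every vertical line meets it in a connected set, and *convex* if every vertical and every horizontal line does. For an $x$-monotone polyomino $P$, the *decomposition number* $d(P)$ is the minimum number of vertical cut lines between columns of $\mathbb Z^2$ that subdivide $P$ into subpolyominoes that are all convex. A *workspace* is a planar grid whose cells are obstacles (all but finitely many) or not; cells that are not obstacles may contain red or blue unit tiles. Two tiles in edge-adjacent cells stick together if and only if their colours differ; maximal sets of tiles that stick together are *assemblies*. A *unit step* (movement step) is one of up, right, down, left: all assemblies simultaneously move cell by cell in this direction, sticking together as soon as they touch, until each of them is blocked by an obstacle or by a blocked assembly. A sequence of unit steps *assembles* $P$ if, in some workspace and from some initial placement of tiles in which no two tiles stick together, it leads to a configuration in which a translate of $P$ (a *copy* of $P$) is an assembly. **Theorem.** There is an absolute constant $C$ such that the following holds for every $x$-monotone polyomino $P$ with $d(P)>0$. Put $L=\lceil\log_2(1+d(P))\rceil$. 1. $P$ can be assembled in at most $C\cdot L$ unit steps. 2. The process can be pipelined, with amortized $O(1)$ unit steps per copy: there are a sequence (cycle) of at most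 $C$ unit steps and a number $m\le C\cdot L$ such that for every $D\ge 0$ there are a workspace and an initial placement of tiles, no two of them sticking together, for which repeating the cycle has the following effect. For every $0\le j\le D$, exactly $j$ copies of $P$ are present after $m+j$ cycles; moreover there is a fixed output place at which a copy is present at the end of each of the cycles $m+1,\dots,m+D$, and which contains no copy at some fixed moment of each of the cycles $m+1,\dots,m+D+1$. In particular $D$ copies are produced within $C\cdot(L+D)$ unit steps, which is $O(1)$ per copy as soon as $D\ge L$. -/

import Mathlib

namespace TiltAssembly

/-! ### Polyominoes and the decomposition number -/

/-- Cells of the planar grid; the unit square centred at the point `p` is identified with `p`. -/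
abbrev Cell : Type := ℤ × ℤ

/-- The grid graph: two points are adjacent if they are at unit (Euclidean) distance. -/
def gridGraph : SimpleGraph Cell where
  Adj p q := |p.1 - q.1| + |p.2 - q.2| = 1
  symm := ⟨fun p q h => by rw [abs_sub_comm q.1, abs_sub_comm q.2]; exact h⟩
  loopless := ⟨fun p h => by simp at h⟩

/-- A polyomino: a finite set of cells whose induced grid graph is connected
(in particular it is not empty). -/
def IsPolyomino (P : Finset Cell) : Prop :=
  (gridGraph.induce (P : Set Cell)).Connected

/-- Column convexity: every vertical line meets `P` in a connected set. -/
def ColumnConvex (P : Finset Cell) : Prop :=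
  ∀ x y₁ y₂ y₃ : ℤ, y₁ ≤ y₂ → y₂ ≤ y₃ → (x, y₁) ∈ P → (x, y₃) ∈ P → (x, y₂) ∈ P

/-- Row convexity: every horizontal line meets `P` in a connected set. -/
def RowConvex (P : Finset Cell) : Prop :=
  ∀ y x₁ x₂ x₃ : ℤ, x₁ ≤ x₂ → x₂ ≤ x₃ → (x₁, y) ∈ P → (x₃, y) ∈ P → (x₂, y) ∈ P

/-- An `x`-monotone polyomino is a column convex polyomino. -/
def IsXMonotone (P : Finset Cell) : Prop :=
  IsPolyomino P ∧ ColumnConvex P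

/-- An (orthogonally) convex polyomino is a column convex and row convex polyomino. -/
def IsConvexPolyomino (P : Finset Cell) : Prop :=
  IsPolyomino P ∧ ColumnConvex P ∧ RowConvex P

/-- A set `S` of integers stands for the set of vertical cut lines `x = c - 1/2`, `c ∈ S`
(the line between the columns `c - 1` and `c`).  `pieceOf P S p` is the part of `P` that is not
separated from `p` by one of these lines. -/
def pieceOf (P : Finset Cell) (S : Finset ℤ) (p : Cell) : Finset Cell :=
  {q ∈ P | ∀ c ∈ S, (q.1 < c ↔ p.1 < c)}

/-- The vertical cuts in `S` subdivide `P` into convex subpolyominoes. -/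
def CutsIntoConvex (P : Finset Cell) (S : Finset ℤ) : Prop :=
  ∀ p ∈ P, IsConvexPolyomino (pieceOf P S p)

/-- The decomposition number: the minimum number of vertical cuts that are required to obtain
subpolyominoes that are all convex. -/
noncomputable def decompNumber (P : Finset Cell) : ℕ :=
  sInf {n : ℕ | ∃ S : Finset ℤ, CutsIntoConvex P S ∧ S.card = n}

/-! ### Workspaces, tiles and movement steps -/

/-- The two kinds of tiles. -/
inductive Color
  | red
  | blue

/-- The four movement steps. -/
inductive Dir
  | up
  | right
  | down
  | left

/-- The unit vector of a direction. -/
def Dir.vec : Dir → Cell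
  | .up => (0, 1)
  | .right => (1, 0)
  | .down => (0, -1)
  | .left => (-1, 0)

/-- A workspace is given by its obstacles.  It is bounded: all but finitely many cells of the plane
are obstacles. -/
structure Workspace where
  obstacles : Set Cell
  finite_free : obstaclesᶜ.Finite

/-- A configuration tells which cells are occupied by a tile, and the colour of that tile. -/
abbrev Config : Type := Cell → Option Color

/-- Adjacent tiles stick together if and only if their colours differ. -/
def bondGraph (c : Config) : SimpleGraph Cell where
  Adj p q := gridGraph.Adj p q ∧ ∃ a b : Color, c p = some a ∧ c q = some b ∧ a ≠ b
  symm := ⟨fun _ _ ⟨h, a, b, ha, hb, hab⟩ => ⟨h.symm, b, a, hb, ha, hab.symm⟩⟩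
  loopless := ⟨fun _ h => gridGraph.irrefl h.1⟩

/-- `A` is (the set of cells of) an assembly: a maximal set of tiles that stick together. -/
def IsAssembly (c : Config) (A : Set Cell) : Prop :=
  ∃ p, c p ≠ none ∧ A = {q | (bondGraph c).Reachable p q}

/-- `Blocked W c d p`: the tile at `p` cannot move in direction `d`, because it is stopped by an
obstacle, by a tile in front of it that cannot move, or by a tile of its own assembly that cannot
move. -/
inductive Blocked (W : Workspace) (c : Config) (d : Dir) : Cell → Prop
  | obstacle (p : Cell) : c p ≠ none → p + d.vec ∈ W.obstacles → Blocked W c d p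
  | tile (p : Cell) : c p ≠ none → Blocked W c d (p + d.vec) → Blocked W c d p
  | bond (p q : Cell) : (bondGraph c).Adj p q → Blocked W c d q → Blocked W c d p

open Classical in
/-- All assemblies that are not blocked advance simultaneously by one cell in direction `d`.
(The cell in front of a tile that is not blocked is free or is vacated at the same time.) -/
noncomputable def advance (W : Workspace) (d : Dir) (c : Config) : Config := fun q =>
  if Blocked W c d q then c q
  else if Blocked W c d (q - d.vec) then none
  else c (q - d.vec)

/-- One movement step from `c` to `c'`: all assemblies advance cell by cell, sticking together as
soon as they touch, until every tile is blocked. -/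
def MovementStep (W : Workspace) (d : Dir) (c c' : Config) : Prop :=
  ∃ n : ℕ, c' = (advance W d)^[n] c ∧ ∀ p, c' p ≠ none → Blocked W c' d p

/-- The sequence `σ` of movement steps turns the configuration `c` into `c'`. -/
def Run (W : Workspace) : List Dir → Config → Config → Prop
  | [], c, c' => c' = c
  | d :: σ, c, c' => ∃ c₁, MovementStep W d c c₁ ∧ Run W σ c₁ c'

/-- Initial configurations: the tiles lie on cells without obstacles, and no two of them stick
together. -/
def IsInitial (W : Workspace) (c : Config) : Prop :=
  (∀ p, c p ≠ none → p ∉ W.obstacles) ∧ ∀ p q, ¬ (bondGraph c).Adj p q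

/-- The translation vectors `v` for which `v + P` is an assembly of `c`; distinct copies of `P`
in `c` correspond to distinct vectors. -/
def copies (c : Config) (P : Finset Cell) : Set Cell :=
  {v | IsAssembly c ((fun p => v + p) '' (P : Set Cell))}

/-- The factor `⌈log₂ (1 + d(P))⌉`. -/
noncomputable def logDecomp (P : Finset Cell) : ℕ :=
  ⌈Real.logb 2 (1 + (decompNumber P : ℝ))⌉₊

/-- `P` can be assembled in at most `k` movement steps, starting from single tiles in a suitable
workspace. -/
def AssembledWithin (P : Finset Cell) (k : ℕ) : Prop :=
  ∃ (W : Workspace) (c₀ c : Config) (σ : List Dir),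
    IsInitial W c₀ ∧ σ.length ≤ k ∧ Run W σ c₀ c ∧ (copies c P).Nonempty

/-- `D` copies of `P` are produced by a pipeline: in a suitable workspace, the fixed sequence `cyc`
of movement steps is repeated, no copy is complete after `m` cycles, and every one of the next `D`
cycles completes exactly one further copy.  There is an output place `v`, common to all copies:
every one of these `D` cycles ends with a copy at `v`, and within each cycle (after its initial
part `τ`) the place `v` has been cleared, so that each cycle delivers a copy anew. -/
def Pipelined (P : Finset Cell) (cyc : List Dir) (m D : ℕ) : Prop :=
  ∃ (W : Workspace) (c₀ : Config) (v : Cell) (τ : List Dir), IsInitial W c₀ ∧ τ <+: cyc ∧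
    ∀ j ≤ D, ∃ c c' : Config, Run W (List.replicate (m + j) cyc).flatten c₀ c ∧
      (copies c P).encard = j ∧ (1 ≤ j → v ∈ copies c P) ∧
      Run W τ c c' ∧ v ∉ copies c' P

end TiltAssembly

open TiltAssembly

/-! No decomposition into convex pieces is needed: every `x`-monotone polyomino with at least two
cells admits a pipeline whose cycle has two steps. The condition `0 < decompNumber P` serves only to
give two cells (`two_le_card`) and `1 ≤ logDecomp P` (`one_le_logDecomp`).

List the cells column by column from right to left so that each is adjacent to an earlier one
(`exists_sweep`), and colour them like a checkerboard. Put tile `i` in its own row, `2 * i` cells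
left of its target. In one step to the right, tile `0` is stopped by an obstacle and tile `i`
arrives at time `2 * i`. No halted tile of the group is left of that target, so the tile touches
nothing before it arrives, and there it sticks to an earlier neighbour.

To finish just one copy per cycle, the last tile of each group is held back. Groups stand at
stations `k * (N, N)`, and a cycle (right, then vertical) carries each to the next station. Before
station `0` the last tile travels at offset `(-G, G)` from its place. Its climb out of station `-1`
is cut short by `G` and the next move to the right is longer by `G`, so it joins the body at station
`0`. Everything off the tracks is an obstacle. As `G` exceeds the extent of `P` and `N` is much
larger, the required stops survive. The body needs a stop in the vertical step too, which requires
that the last cell not be the unique topmost one; a reflection ensures this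
(`exists_extreme_before_last`).

Each step is verified by prescribing the halting time of every tile (`movementStep_tilesAt`,
`movementStep_mirror`); `copies_tilesAt` counts the copies. -/

theorem adj_iff (p q : Cell) : gridGraph.Adj p q ↔
    (p.1 = q.1 ∧ (p.2 = q.2 + 1 ∨ q.2 = p.2 + 1)) ∨
    (p.2 = q.2 ∧ (p.1 = q.1 + 1 ∨ q.1 = p.1 + 1)) := by
  change |p.1 - q.1| + |p.2 - q.2| = 1 ↔ _
  rcases abs_cases (p.1 - q.1) with h | h <;> rcases abs_cases (p.2 - q.2) with h' | h' <;> omega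

/-! ### Sweeping an `x`-monotone polyomino from right to left -/

/-- `p 0, …, p (n - 1)` are distinct cells, sorted by columns from right to left, each of which
is adjacent to an earlier one. -/
structure Sweep (n : ℕ) (p : ℕ → Cell) : Prop where
  inj : ∀ i < n, ∀ j < n, p i = p j → i = j
  anti : ∀ i j, i ≤ j → j < n → (p j).1 ≤ (p i).1
  link : ∀ i, 0 < i → i < n → ∃ j < i, gridGraph.Adj (p j) (p i)

/-- A connected set that meets both `A` and its complement has an edge between the two. -/
theorem exists_crossing_edge {P : Finset Cell} (hP : IsPolyomino P) {A : Finset Cell} {a r : Cell}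
    (ha : a ∈ P) (haA : a ∈ A) (hr : r ∈ P) (hrA : r ∉ A) :
    ∃ q ∈ P, ∃ q' ∈ P, q ∈ A ∧ q' ∉ A ∧ gridGraph.Adj q q' := by
  by_contra! h
  obtain ⟨w⟩ := hP.preconnected ⟨a, ha⟩ ⟨r, hr⟩
  have key : ∀ (x y : (P : Set Cell)), (gridGraph.induce (P : Set Cell)).Walk x y →
      x.1 ∈ A → y.1 ∈ A := by
    intro x y w
    induction w with
    | nil => exact id
    | @cons x y z e _ ih =>
      intro hx
      apply ih
      by_contra hy
      exact h x.1 x.2 y.1 y.2 hx hy e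
  exact hrA (key _ _ w haA)

theorem exists_column_edge {P : Finset Cell} (hP : ColumnConvex P) {A : Finset Cell} {x y z : ℤ}
    (hy : (x, y) ∈ P) (hyA : (x, y) ∈ A) (hz : (x, z) ∈ P) (hzA : (x, z) ∉ A) :
    ∃ t t', (x, t) ∈ A ∧ (x, t') ∈ P ∧ (x, t') ∉ A ∧ gridGraph.Adj (x, t) (x, t') := by
  by_contra! h
  rcases le_total y z with hyz | hyz
  · have key : ∀ w, y ≤ w → w ≤ z → (x, w) ∈ A := by
      intro w hw
      induction w, hw using Int.leInduction with
      | base => exact fun _ => hyA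
      | succ w hw ih =>
        intro hwz
        by_contra hn
        exact h w (w + 1) (ih (by omega)) (hP x y (w + 1) z (by omega) hwz hy hz) hn
          ((adj_iff _ _).2 (by simp))
    exact hzA (key z hyz le_rfl)
  · have key : ∀ w, w ≤ y → z ≤ w → (x, w) ∈ A := by
      intro w hw
      induction w, hw using Int.leInductionDown with
      | base => exact fun _ => hyA
      | pred w hw ih =>
        intro hwz
        by_contra hn
        exact h w (w - 1) (ih (by omega)) (hP x z (w - 1) y hwz (by omega) hz hy) hn
          ((adj_iff _ _).2 (by simp))
    exact hzA (key z hyz le_rfl)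

/-- Consider the rightmost column with a missing cell. If `A` meets it, column convexity gives a
neighbour inside this column. Otherwise any edge leaving `A` starts further right, so it must end in
this column. -/
theorem exists_next {P : Finset Cell} (hP : IsXMonotone P) {A : Finset Cell} (hA : A.Nonempty)
    (hAP : A ⊂ P) (hright : ∀ a ∈ A, ∀ q ∈ P, q ∉ A → q.1 ≤ a.1) :
    ∃ q ∈ P, q ∉ A ∧ (∃ a ∈ A, gridGraph.Adj a q) ∧ ∀ q' ∈ P, q' ∉ A → q'.1 ≤ q.1 := by
  obtain ⟨a₀, ha₀⟩ := hA
  obtain ⟨r₀, hr₀⟩ : (P \ A).Nonempty := Finset.sdiff_nonempty.2 hAP.2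
  obtain ⟨r, hr, hmax⟩ := Finset.exists_max_image (P \ A) Prod.fst ⟨r₀, hr₀⟩
  rw [Finset.mem_sdiff] at hr
  have hmax' : ∀ q' ∈ P, q' ∉ A → q'.1 ≤ r.1 :=
    fun q' h h' => hmax q' (Finset.mem_sdiff.2 ⟨h, h'⟩)
  have hcol : ∀ a ∈ A, a.1 = r.1 → ∃ q ∈ P, q ∉ A ∧ (∃ a ∈ A, gridGraph.Adj a q) ∧
      ∀ q' ∈ P, q' ∉ A → q'.1 ≤ q.1 := by
    rintro ⟨x, y⟩ ha hx
    obtain ⟨x', z⟩ := r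
    obtain rfl : x = x' := hx
    obtain ⟨t, t', h1, h2, h3, h4⟩ := exists_column_edge hP.2 (hAP.1 ha) ha hr.1 hr.2
    exact ⟨_, h2, h3, ⟨_, h1, h4⟩, hmax'⟩
  obtain ⟨q, hq, q', hq', hqA, hqA', e⟩ :=
    exists_crossing_edge hP.1 (hAP.1 ha₀) ha₀ hr.1 hr.2
  rcases eq_or_ne q.1 r.1 with h | h
  · exact hcol q hqA h
  · refine ⟨q', hq', hqA', ⟨q, hqA, e⟩, fun s hs hsA => ?_⟩
    have h1 := hright q hqA r hr.1 hr.2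
    have h2 := hmax' q' hq' hqA'
    have h3 := hmax' s hs hsA
    rw [adj_iff] at e
    omega

/-- Greedy construction; the last clause is the invariant that `exists_next` needs. -/
theorem exists_sweep_prefix {P : Finset Cell} (hP : IsXMonotone P) (m : ℕ) (hm : m + 1 ≤ P.card) :
    ∃ p : ℕ → Cell, Sweep (m + 1) p ∧ (∀ i < m + 1, p i ∈ P) ∧
      ∀ q ∈ P, (∀ i < m + 1, p i ≠ q) → ∀ i < m + 1, q.1 ≤ (p i).1 := by
  induction m with
  | zero =>
    obtain ⟨r, hr, hmax⟩ := Finset.exists_max_image P Prod.fst (Finset.card_pos.1 (by omega))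
    refine ⟨fun _ => r, ⟨fun i hi j hj _ => by omega, fun _ _ _ _ => le_rfl,
      fun i hi hi' => by omega⟩, fun _ _ => hr, fun q hq _ _ _ => hmax q hq⟩
  | succ m ih =>
    obtain ⟨p, hp, hpP, hright⟩ := ih (by omega)
    set A := (Finset.range (m + 1)).image p with hA
    have memA : ∀ q, q ∈ A ↔ ∃ i < m + 1, p i = q := by intro q; simp [hA]
    have hAP : A ⊆ P := by
      intro q hq
      obtain ⟨i, hi, rfl⟩ := (memA q).1 hq
      exact hpP i hi
    have hcard : A.card ≤ m + 1 := Finset.card_image_le.trans (by simp)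
    have hss : A ⊂ P := Finset.ssubset_of_subset_of_ssubset subset_rfl
      (hAP.ssubset_of_ne (by rintro h; rw [h] at hcard; omega))
    obtain ⟨q, hq, hqA, ⟨a, ha, e⟩, hmax⟩ := exists_next hP ⟨p 0, (memA _).2 ⟨0, by omega, rfl⟩⟩
      hss (by
        rintro a ha q hq hqA
        obtain ⟨i, hi, rfl⟩ := (memA a).1 ha
        exact hright q hq (fun j hj h => hqA ((memA q).2 ⟨j, hj, h⟩)) i hi)
    have hne : ∀ i < m + 1, p i ≠ q := fun j hj h => hqA ((memA q).2 ⟨j, hj, h⟩)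
    refine ⟨fun i => if i < m + 1 then p i else q, ⟨?_, ?_, ?_⟩, ?_, ?_⟩
    · intro i hi j hj h
      by_cases h1 : i < m + 1 <;> by_cases h2 : j < m + 1 <;> simp only [h1, h2, if_true, if_false] at h
      · exact hp.inj i h1 j h2 h
      · exact absurd h (hne i h1)
      · exact absurd h.symm (hne j h2)
      · omega
    · intro i j hij hj
      by_cases h1 : i < m + 1 <;> by_cases h2 : j < m + 1 <;> simp only [h1, h2, if_true, if_false]
      · exact hp.anti i j hij h2
      · exact hright q hq hne i h1
      · omega
      · exact le_rfl
    · intro i hi hi'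
      by_cases h1 : i < m + 1
      · obtain ⟨j, hj, e⟩ := hp.link i hi h1
        exact ⟨j, hj, by simpa [h1, hj.trans h1] using e⟩
      · obtain ⟨j, hj, rfl⟩ := (memA a).1 ha
        exact ⟨j, by omega, by simpa [h1, hj] using e⟩
    · intro i hi
      dsimp only
      split_ifs with h1
      exacts [hpP i h1, hq]
    · intro r hr hrne i hi
      have hr' : ∀ i < m + 1, p i ≠ r := fun j hj => by simpa [hj] using hrne j (by omega)
      dsimp only
      split_ifs with h1
      · exact hright r hr hr' i h1
      · exact hmax r hr (fun h => by obtain ⟨j, hj, h⟩ := (memA r).1 h; exact hr' j hj h)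

theorem TiltAssembly.IsXMonotone.exists_sweep {P : Finset Cell} (hP : IsXMonotone P) (h0 : 0 < P.card) :
    ∃ p : ℕ → Cell, Sweep P.card p ∧ (Finset.range P.card).image p = P := by
  obtain ⟨p, hp, hpP, -⟩ := exists_sweep_prefix hP (P.card - 1) (by omega)
  rw [Nat.sub_add_cancel h0] at hp hpP
  refine ⟨p, hp, Finset.eq_of_subset_of_card_le ?_ ?_⟩
  · intro q hq
    obtain ⟨i, hi, rfl⟩ := Finset.mem_image.1 hq
    exact hpP i (Finset.mem_range.1 hi)
  · rw [Finset.card_image_of_injOn, Finset.card_range]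
    intro i hi j hj h
    exact hp.inj i (by simpa using hi) j (by simpa using hj) h

/-- A property of the indices that spreads between adjacent cells holds everywhere if it holds
somewhere. -/
theorem Sweep.spread {n : ℕ} {p : ℕ → Cell} (hp : Sweep n p) {B : ℕ → Prop}
    (hB : ∀ i < n, ∀ j < n, gridGraph.Adj (p i) (p j) → B i → B j) {u i : ℕ} (hu : u < n)
    (hBu : B u) (hi : i < n) : B i := by
  have key : ∀ i < n, (B i ↔ B 0) := by
    intro i
    induction i using Nat.strong_induction_on with
    | _ i ih =>
      intro hi
      rcases Nat.eq_zero_or_pos i with rfl | h0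
      · rfl
      · obtain ⟨j, hj, e⟩ := hp.link i h0 hi
        rw [← ih j hj (hj.trans hi)]
        exact ⟨hB i hi j (hj.trans hi) e.symm, hB j (hj.trans hi) i hi e⟩
  exact (key i hi).2 ((key u hu).1 hBu)

theorem Sweep.mono {m n : ℕ} {p : ℕ → Cell} (hp : Sweep n p) (h : m ≤ n) : Sweep m p :=
  ⟨fun i hi j hj => hp.inj i (by omega) j (by omega), fun i j hij hj => hp.anti i j hij (by omega),
    fun i hi hi' => hp.link i hi (by omega)⟩

theorem TiltAssembly.IsXMonotone.two_le_card {P : Finset Cell} (hP : IsXMonotone P)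
    (hd : 0 < decompNumber P) : 2 ≤ P.card := by
  by_contra! h
  have h1 : ∀ a ∈ P, ∀ b ∈ P, a = b := Finset.card_le_one.1 (by omega)
  have : decompNumber P = 0 := by
    refine Nat.sInf_eq_zero.2 (Or.inl ⟨∅, fun p _ => ?_, rfl⟩)
    have : pieceOf P ∅ p = P := by simp [pieceOf]
    rw [this]
    refine ⟨hP.1, hP.2, fun y x₁ x₂ x₃ h12 h23 m1 m3 => ?_⟩
    have := congrArg Prod.fst (h1 _ m1 _ m3)
    obtain rfl : x₁ = x₂ := by simp at this; omega
    exact m1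
  omega

/-! ### Configurations of indexed tiles and their motion -/

open Classical in
/-- The configuration with a tile of colour `col a` at `f a`, for every index `a`. -/
noncomputable def tilesAt {ι : Type*} (col : ι → Color) (f : ι → Cell) : Config := fun q =>
  if h : ∃ a, f a = q then some (col h.choose) else none

section tilesAt

variable {ι : Type*} {col : ι → Color} {f : ι → Cell}

theorem tilesAt_apply (hf : Function.Injective f) (a : ι) :
    tilesAt col f (f a) = some (col a) := by
  have h : ∃ b, f b = f a := ⟨a, rfl⟩
  rw [tilesAt, dif_pos h, hf h.choose_spec]

theorem tilesAt_ne_none {q : Cell} : tilesAt col f q ≠ none ↔ ∃ a, f a = q := by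
  unfold tilesAt
  split_ifs with h <;> simp [h]

theorem tilesAt_eq_none {q : Cell} (h : ∀ a, f a ≠ q) : tilesAt col f q = none := by
  by_contra hn
  obtain ⟨a, ha⟩ := tilesAt_ne_none.1 hn
  exact h a ha

theorem tilesAt_bond_iff (hf : Function.Injective f) {p q : Cell} :
    (bondGraph (tilesAt col f)).Adj p q ↔
      ∃ a b, f a = p ∧ f b = q ∧ gridGraph.Adj p q ∧ col a ≠ col b := by
  constructor
  · rintro ⟨e, x, y, hx, hy, hxy⟩
    obtain ⟨a, rfl⟩ := tilesAt_ne_none.1 (hx ▸ Option.some_ne_none x : tilesAt col f p ≠ none)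
    obtain ⟨b, rfl⟩ := tilesAt_ne_none.1 (hy ▸ Option.some_ne_none y : tilesAt col f q ≠ none)
    rw [tilesAt_apply hf] at hx hy
    exact ⟨a, b, rfl, rfl, e, by simp_all⟩
  · rintro ⟨a, b, rfl, rfl, e, h⟩
    exact ⟨e, _, _, tilesAt_apply hf a, tilesAt_apply hf b, h⟩

end tilesAt

theorem TiltAssembly.Blocked.ne_none {W : Workspace} {c : Config} {d : Dir} {p : Cell}
    (h : Blocked W c d p) : c p ≠ none := by
  cases h with
  | obstacle _ h _ => exact h
  | tile _ h _ => exact h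
  | bond _ q h _ =>
    obtain ⟨-, a, b, ha, -, -⟩ := h
    simp [ha]

/-- If every tile moves freely up to its own time `T a` and is blocked from then on, then the
movement step consists of these motions. -/
theorem movementStep_tilesAt {ι : Type*} (W : Workspace) (d : Dir) (col : ι → Color)
    (start : ι → Cell) (T : ι → ℕ) (N : ℕ) (hinj : Function.Injective start)
    (hT : ∀ a, T a ≤ N) (f : ℕ → ι → Cell)
    (hf : ∀ s a, f s a = start a + ((min s (T a) : ℕ) : ℤ) • d.vec)
    (go : ∀ s a, s < T a → f s a + d.vec ∉ W.obstacles)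
    (sep : ∀ s a b, s < T a → T b ≤ s → ¬ gridGraph.Adj (f s a) (f s b))
    (halt : ∀ s a, Function.Injective (f s) → T a ≤ s →
      Blocked W (tilesAt col (f s)) d (f s a)) :
    Function.Injective (f N) ∧ MovementStep W d (tilesAt col start) (tilesAt col (f N)) := by
  have f0 : f 0 = start := by funext a; simp [hf]
  have fhalt : ∀ s a, T a ≤ s → f (s + 1) a = f s a := by
    intro s a h
    rw [hf, hf, min_eq_right h, min_eq_right (h.trans (Nat.le_succ s))]
  have fgo : ∀ s a, s < T a → f (s + 1) a = f s a + d.vec := by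
    intro s a h
    rw [hf, hf, min_eq_left h.le, min_eq_left h]
    push_cast
    rw [add_smul, one_smul, add_assoc]
  have adjvec : ∀ p : Cell, gridGraph.Adj p (p + d.vec) := by
    intro p
    rw [adj_iff]
    cases d <;> simp [Dir.vec]
  have inj : ∀ s, Function.Injective (f s) := by
    intro s
    induction s with
    | zero => rwa [f0]
    | succ s ih =>
      -- A moving tile that runs into a halted one would have been adjacent to it one unit earlier,
      -- against `sep`.
      have mixed : ∀ a b, s < T a → T b ≤ s → f (s + 1) a ≠ f (s + 1) b := by
        intro a b ha hb h
        rw [fgo s a ha, fhalt s b hb] at h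
        exact sep s a b ha hb (h ▸ adjvec _)
      intro a b h
      rcases lt_or_ge s (T a) with ha | ha <;> rcases lt_or_ge s (T b) with hb | hb
      · rw [fgo s a ha, fgo s b hb] at h
        exact ih (add_right_cancel h)
      · exact absurd h (mixed a b ha hb)
      · exact absurd h.symm (mixed b a hb ha)
      · rw [fhalt s a ha, fhalt s b hb] at h
        exact ih h
  -- `Blocked` is a least predicate, so induction applies: `go` excludes obstacles ahead of a moving
  -- tile, and `sep` excludes contact with a halted one.
  have blocked : ∀ s a, Blocked W (tilesAt col (f s)) d (f s a) → T a ≤ s := by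
    intro s a h
    generalize hp : f s a = p at h
    induction h generalizing a with
    | obstacle p _ ho =>
      by_contra hlt
      subst hp
      exact go s a (not_le.1 hlt) ho
    | tile p _ hb ih =>
      subst hp
      obtain ⟨b, hb⟩ := tilesAt_ne_none.1 hb.ne_none
      by_contra hlt
      exact sep s a b (not_le.1 hlt) (ih b hb) (hb ▸ adjvec _)
    | bond p q h hb ih =>
      subst hp
      obtain ⟨b, hb⟩ := tilesAt_ne_none.1 hb.ne_none
      by_contra hlt
      exact sep s a b (not_le.1 hlt) (ih b hb) (hb ▸ h.1)
  have step : ∀ s, advance W d (tilesAt col (f s)) = tilesAt col (f (s + 1)) := by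
    intro s
    funext q
    unfold advance
    split_ifs with h1 h2
    · obtain ⟨a, rfl⟩ := tilesAt_ne_none.1 h1.ne_none
      rw [tilesAt_apply (inj s), ← fhalt s a (blocked s a h1), tilesAt_apply (inj _)]
    · refine (tilesAt_eq_none fun a ha => ?_).symm
      rcases lt_or_ge s (T a) with h | h
      · rw [fgo s a h] at ha
        rw [← ha, add_sub_cancel_right] at h2
        exact absurd (blocked s a h2) (not_le.2 h)
      · rw [fhalt s a h] at ha
        exact h1 (ha ▸ halt s a (inj s) h)
    · by_cases h : ∃ a, f s a = q - d.vec
      · obtain ⟨a, ha⟩ := h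
        rw [← ha] at h2 ⊢
        have hlt : s < T a := not_le.1 fun h => h2 (halt s a (inj s) h)
        have hq : q = f (s + 1) a := by rw [fgo s a hlt, ha, sub_add_cancel]
        rw [hq, tilesAt_apply (inj s), tilesAt_apply (inj _)]
      · push Not at h
        rw [tilesAt_eq_none h, tilesAt_eq_none]
        intro a ha
        rcases lt_or_ge s (T a) with hlt | hle
        · rw [fgo s a hlt] at ha
          exact h a (by rw [← ha, add_sub_cancel_right])
        · rw [fhalt s a hle] at ha
          exact h1 (ha ▸ halt s a (inj s) hle)
  have iter : ∀ s, (advance W d)^[s] (tilesAt col start) = tilesAt col (f s) := by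
    intro s
    induction s with
    | zero => simp [f0]
    | succ s ih => rw [Function.iterate_succ_apply', ih, step]
  refine ⟨inj N, N, (iter N).symm, fun p hp => ?_⟩
  obtain ⟨a, rfl⟩ := tilesAt_ne_none.1 hp
  exact halt N a (inj N) (hT a)

/-! ### Movement steps in reflected coordinates -/

/-- The identity for `ε = 1`, the reflection in the horizontal axis for `ε = -1`. -/
def mirror (ε : ℤ) (p : Cell) : Cell := (p.1, ε * p.2)

theorem mirror_add (ε : ℤ) (p q : Cell) : mirror ε (p + q) = mirror ε p + mirror ε q :=
  Prod.ext rfl (mul_add _ _ _)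

theorem mirror_smul (ε k : ℤ) (p : Cell) : mirror ε (k • p) = k • mirror ε p :=
  Prod.ext rfl (mul_left_comm _ _ _)

theorem mirror_mirror {ε : ℤ} (hε : ε * ε = 1) (p : Cell) : mirror ε (mirror ε p) = p :=
  Prod.ext rfl (by simp [mirror, ← mul_assoc, hε])

theorem mirror_injective {ε : ℤ} (hε : ε * ε = 1) : Function.Injective (mirror ε) :=
  Function.LeftInverse.injective (mirror_mirror hε)

theorem mirror_adj {ε : ℤ} (hε : ε * ε = 1) (p q : Cell) :
    gridGraph.Adj (mirror ε p) (mirror ε q) ↔ gridGraph.Adj p q := by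
  rw [adj_iff, adj_iff]
  rcases mul_self_eq_one_iff.1 hε with rfl | rfl <;> simp only [mirror] <;> omega

/-- `movementStep_tilesAt` in mirrored coordinates.  The tiles that end up blocked are described by
an induction principle, starting from tiles in front of obstacles. -/
theorem movementStep_mirror {ι : Type*} {ε : ℤ} (hε : ε * ε = 1) (W : Workspace) (free : Set Cell)
    (hW : ∀ q, mirror ε q ∉ W.obstacles ↔ q ∈ free) (d : Dir) (e : Cell)
    (hd : d.vec = mirror ε e) (col : ι → Color) (start halt : ι → Cell) (T : ι → ℕ) (N : ℕ)
    (hinj : Function.Injective start) (hT : ∀ a, T a ≤ N)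
    (hhalt : ∀ a, halt a = start a + (T a : ℤ) • e)
    (go : ∀ a, ∀ s ≤ T a, 0 < s → start a + (s : ℤ) • e ∈ free)
    (sep : ∀ s a b, s < T a → T b ≤ s → ¬ gridGraph.Adj (start a + (s : ℤ) • e) (halt b))
    (blocked : ∀ (B : ι → Prop) (a : ι), (∀ b, T b ≤ T a → halt b + e ∉ free → B b) →
      (∀ b b', T b ≤ T a → T b' ≤ T a → gridGraph.Adj (halt b) (halt b') → col b ≠ col b' →
        B b → B b') → B a) :
    Function.Injective halt ∧ MovementStep W d (tilesAt col fun a => mirror ε (start a))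
      (tilesAt col fun a => mirror ε (halt a)) := by
  set f : ℕ → ι → Cell := fun s a => mirror ε (start a + ((min s (T a) : ℕ) : ℤ) • e) with hf
  have fge : ∀ s a, T a ≤ s → f s a = mirror ε (halt a) := by
    intro s a h
    simp only [hf, min_eq_right h, hhalt]
  have flt : ∀ s a, s < T a → f s a = mirror ε (start a + (s : ℤ) • e) := by
    intro s a h
    simp only [hf, min_eq_left h.le]
  have fN : f N = fun a => mirror ε (halt a) := funext fun a => fge N a (hT a)
  rw [← fN]
  have := movementStep_tilesAt W d col (fun a => mirror ε (start a)) T N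
    ((mirror_injective hε).comp hinj) hT f
    (fun s a => by simp only [hf, mirror_add, mirror_smul, hd]) ?_ ?_ ?_
  · refine ⟨?_, this.2⟩
    have h1 := this.1
    rw [fN] at h1
    exact fun a b h => h1 (congrArg (mirror ε) h)
  · intro s a h
    rw [flt s a h, hd, ← mirror_add, hW]
    have := go a (s + 1) h (Nat.succ_pos s)
    push_cast at this
    rwa [add_smul, one_smul, ← add_assoc] at this
  · intro s a b ha hb
    rw [flt s a ha, fge s b hb, mirror_adj hε]
    exact sep s a b ha hb
  · intro s a inj ha
    refine blocked (fun b => T b ≤ s → Blocked W (tilesAt col (f s)) d (f s b)) a ?_ ?_ ha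
    · intro b hb hfree hbs
      refine Blocked.obstacle _ (tilesAt_ne_none.2 ⟨b, rfl⟩) ?_
      rw [fge s b hbs, hd, ← mirror_add]
      exact not_not.1 fun h => hfree ((hW _).1 h)
    · intro b b' hb hb' e hcol hB hs
      refine Blocked.bond _ _ ?_ (hB (hb.trans ha))
      refine (tilesAt_bond_iff inj).2 ⟨b', b, rfl, rfl, ?_, hcol.symm⟩
      rw [fge s b (hb.trans ha), fge s b' hs, mirror_adj hε]
      exact e.symm

/-! ### Counting copies -/

theorem translate_injective {P : Finset Cell} (hP : P.Nonempty) {v w : Cell}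
    (h : (fun p => v + p) '' (P : Set Cell) = (fun p => w + p) '' (P : Set Cell)) : v = w := by
  have h' : P.image (fun p => v + p) = P.image (fun p => w + p) := by
    apply Finset.coe_injective
    simpa using h
  have hs : ∑ p ∈ P, (v + p) = ∑ p ∈ P, (w + p) := by
    have := congrArg (fun A : Finset Cell => ∑ q ∈ A, q) h'
    rwa [Finset.sum_image (fun _ _ _ _ h => add_left_cancel h),
      Finset.sum_image (fun _ _ _ _ h => add_left_cancel h)] at this
  rw [Finset.sum_add_distrib, Finset.sum_add_distrib, add_left_inj, Finset.sum_const,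
    Finset.sum_const] at hs
  exact nsmul_right_injective hP.card_pos.ne' hs

/-- A configuration of groups of `n` tiles each.  The tiles of a `done` group form a copy of `P`; in
the other groups, the last tile is not attached. -/
theorem copies_tilesAt {J : Type*} {ε : ℤ} (hε : ε * ε = 1) {n : ℕ} {p : ℕ → Cell} (hp : Sweep n p)
    (hn : 2 ≤ n) (col : ℕ → Color) (hcol : ∀ i j, gridGraph.Adj (p i) (p j) → col i ≠ col j)
    (f : J × Fin n → Cell) (hf : Function.Injective f) (base : J → Cell) (done : J → Prop)
    (hbase : ∀ a, done a.1 → f a = base a.1 + p a.2)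
    (hadj : ∀ a b, gridGraph.Adj (f a) (f b) →
      a.1 = b.1 ∧ (done a.1 ∨ ((a.2 : ℕ) + 1 < n ∧ (b.2 : ℕ) + 1 < n)))
    (P : Finset Cell) (hP : P = (Finset.range n).image fun i => mirror ε (p i)) :
    copies (tilesAt (fun a => col a.2) fun a => mirror ε (f a)) P =
      (fun j => mirror ε (base j)) '' {j | done j} := by
  have memP : ∀ q, q ∈ P ↔ ∃ i : Fin n, mirror ε (p i) = q := by
    intro q
    rw [hP, Finset.mem_image]
    exact ⟨fun ⟨i, hi, h⟩ => ⟨⟨i, Finset.mem_range.1 hi⟩, h⟩,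
      fun ⟨i, h⟩ => ⟨i, Finset.mem_range.2 i.2, h⟩⟩
  have hcard : P.card = n := by
    rw [hP, Finset.card_image_of_injOn, Finset.card_range]
    intro i hi j hj h
    exact hp.inj i (by simpa using hi) j (by simpa using hj) (mirror_injective hε h)
  have hPne : P.Nonempty := Finset.card_pos.1 (by omega)
  set g : J × Fin n → Cell := fun a => mirror ε (f a) with hg
  have ginj : Function.Injective g := (mirror_injective hε).comp hf
  set c := tilesAt (fun a : J × Fin n => col a.2) g with hc
  -- An upper bound for the assembly of `a`: the whole group if it is done, otherwise either the
  -- body or the last tile alone. A copy has `n` cells, so it forces this set to be everything.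
  set comp : J × Fin n → Set (Fin n) :=
    fun a => {i | done a.1 ∨ ((i : ℕ) + 1 < n ↔ (a.2 : ℕ) + 1 < n)} with hcomp
  have reach : ∀ a q, (bondGraph c).Reachable (g a) q → q ∈ (fun i => g (a.1, i)) '' comp a := by
    rintro a q ⟨w⟩
    have key : ∀ x y, (bondGraph c).Walk x y → x ∈ (fun i => g (a.1, i)) '' comp a →
        y ∈ (fun i => g (a.1, i)) '' comp a := by
      intro x y w
      induction w with
      | nil => exact id
      | @cons x y z e _ ih =>
        rintro ⟨i, hi, rfl⟩
        apply ih
        obtain ⟨b, b', hb, rfl, e, -⟩ := (tilesAt_bond_iff ginj).1 e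
        obtain rfl := ginj hb
        simp only [hg] at e
        rw [mirror_adj hε] at e
        obtain ⟨h1, h2⟩ := hadj _ _ e
        refine ⟨b'.2, ?_, ?_⟩
        · rcases h2 with h2 | h2
          · exact Or.inl h2
          · rcases hi with hi | hi
            · exact Or.inl hi
            · exact Or.inr ⟨fun _ => hi.1 h2.1, fun _ => h2.2⟩
        · simp only at h1
          rw [h1]
    exact key _ _ w ⟨a.2, Or.inr Iff.rfl, rfl⟩
  have body : ∀ j, done j → Set.range (fun i => g (j, i)) =
      (fun q => mirror ε (base j) + q) '' (P : Set Cell) := by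
    intro j hj
    ext q
    simp only [Set.mem_range, Set.mem_image, Finset.mem_coe, memP]
    constructor
    · rintro ⟨i, rfl⟩
      exact ⟨_, ⟨i, rfl⟩, by simp only [hg]; rw [hbase (j, i) hj, mirror_add]⟩
    · rintro ⟨_, ⟨i, rfl⟩, rfl⟩
      exact ⟨i, by simp only [hg]; rw [hbase (j, i) hj, mirror_add]⟩
  ext v
  constructor
  · rintro ⟨x, hx, hA⟩
    obtain ⟨a, rfl⟩ := tilesAt_ne_none.1 hx
    have hsub : (fun q => v + q) '' (P : Set Cell) ⊆ (fun i => g (a.1, i)) '' comp a := by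
      rw [hA]
      exact fun q hq => reach a q hq
    have hAcard : ((fun q => v + q) '' (P : Set Cell)).ncard = n := by
      rw [Set.ncard_image_of_injective _ (add_right_injective v), Set.ncard_coe_finset, hcard]
    have hle := Set.ncard_le_ncard hsub ((Set.toFinite _).image _)
    rw [hAcard] at hle
    have hle' : n ≤ (comp a).ncard := hle.trans (Set.ncard_image_le (Set.toFinite _))
    have huniv : comp a = Set.univ := by
      apply Set.eq_of_subset_of_ncard_le (Set.subset_univ _) _ (Set.toFinite _)
      rwa [Set.ncard_univ, Nat.card_fin]
    have hdone : done a.1 := by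
      by_contra hnd
      have h0 : (⟨0, by omega⟩ : Fin n) ∈ comp a := huniv ▸ Set.mem_univ _
      have h1 : (⟨n - 1, by omega⟩ : Fin n) ∈ comp a := huniv ▸ Set.mem_univ _
      simp only [hcomp, hnd, false_or, Set.mem_ofPred_eq] at h0 h1
      omega
    refine ⟨a.1, hdone, translate_injective hPne ?_⟩
    rw [← body _ hdone, eq_comm, ← Set.image_univ, ← huniv]
    refine Set.eq_of_subset_of_ncard_le hsub ?_ ((Set.toFinite _).image _)
    rw [hAcard]
    refine (Set.ncard_image_le (Set.toFinite _)).trans ?_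
    rw [huniv, Set.ncard_univ, Nat.card_fin]
  · rintro ⟨j, hj, rfl⟩
    refine ⟨g (j, ⟨0, by omega⟩), tilesAt_ne_none.2 ⟨_, rfl⟩, ?_⟩
    rw [← body j hj]
    ext q
    constructor
    · rintro ⟨i, rfl⟩
      have := hp.spread (u := 0) (i := i) (B := fun i => ∀ h : i < n,
        (bondGraph c).Reachable (g (j, ⟨0, by omega⟩)) (g (j, ⟨i, h⟩))) ?_ (by omega)
        (fun _ => SimpleGraph.Reachable.refl _) i.2
      · exact this i.2
      · intro i hi k hk e h _
        refine (h hi).trans (SimpleGraph.Adj.reachable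
          ((tilesAt_bond_iff ginj).2 ⟨_, _, rfl, rfl, ?_, hcol i k e⟩))
        simp only [hg]
        rw [mirror_adj hε, hbase (j, ⟨i, hi⟩) hj, hbase (j, ⟨k, hk⟩) hj]
        rw [adj_iff] at e ⊢
        simp only [Prod.fst_add, Prod.snd_add]
        omega
    · intro hq
      obtain ⟨i, -, h⟩ := reach _ _ hq
      exact ⟨i, h⟩

/-! ### Stations, tracks and obstacles -/

/-- Checkerboard colouring of the cells `p i`. -/
def checker (p : ℕ → Cell) (i : ℕ) : Color :=
  if Even ((p i).1 + (p i).2) then .red else .blue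

theorem checker_ne {p : ℕ → Cell} {i j : ℕ} (h : gridGraph.Adj (p i) (p j)) :
    checker p i ≠ checker p j := by
  rw [adj_iff] at h
  unfold checker
  by_cases h1 : Even ((p i).1 + (p i).2) <;> by_cases h2 : Even ((p j).1 + (p j).2) <;>
    simp only [h1, h2, if_true, if_false, ne_eq, reduceCtorEq, not_false_eq_true, not_true_eq_false]
  all_goals
    rw [Int.even_iff] at h1 h2
    omega

/-- A sweep of cells (the last of which is not the unique topmost one), and distances `G` and `N`
that are large compared with the extent of these cells. -/
structure Conveyor (n : ℕ) (p : ℕ → Cell) (u G N : ℕ) : Prop extends Sweep n p where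
  two_le : 2 ≤ n
  lt_last : u + 1 < n
  top : ∀ i < n, (p i).2 ≤ (p u).2
  width : ∀ i < n, ∀ j < n, (p i).1 - (p j).1 + 3 ≤ G ∧ (p i).2 - (p j).2 + 3 ≤ G
  big : 4 * G + 2 * n ≤ N

/-- Position of the tile `i` of a group at the station `k` after a step to the right. -/
def posRight (n : ℕ) (p : ℕ → Cell) (G N : ℕ) (k : ℤ) (i : ℕ) : Cell :=
  (k * N + (p i).1 - (if i + 1 = n ∧ k < 0 then (G : ℤ) else 0),
    k * N + (p i).2 + (if i + 1 = n ∧ k < 0 then (G : ℤ) else 0))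

/-- Position of the tile `i` of a group that came up from the station `k`. -/
def posUp (n : ℕ) (p : ℕ → Cell) (G N : ℕ) (k : ℤ) (i : ℕ) : Cell :=
  (k * N + (p i).1 - (if i + 1 = n ∧ k < 0 then (G : ℤ) else 0),
    k * N + N + (p i).2 + (if i + 1 = n ∧ k < -1 then (G : ℤ) else 0))

/-- Initial position of the tile `i` of a group that will be assembled at the station `k`. -/
def posInit (n : ℕ) (p : ℕ → Cell) (G N : ℕ) (k : ℤ) (i : ℕ) : Cell :=
  (k * N + (p i).1 - (if i + 1 = n then (G : ℤ) else 2 * i),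
    k * N + (p i).2 + (if i + 1 = n then (G : ℤ) else 0))

/-- The cells without obstacles: the tracks of all tiles. -/
def freeCells (n : ℕ) (p : ℕ → Cell) (G N B : ℕ) : Set Cell :=
  {q | ∃ k : ℤ, (-B ≤ k ∧ k ≤ B) ∧ ∃ i < n, ∃ a : ℤ, (0 ≤ a ∧ a ≤ N + G) ∧
    ((q.1 = k * N + (p i).1 - a ∧ q.2 = k * N + (p i).2 ∧ (a ≤ N ∨ i + 1 = n)) ∨
     (q.1 = k * N + (p i).1 - G - a ∧ q.2 = k * N + (p i).2 + G ∧ i + 1 = n ∧ a ≤ N) ∨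
     (q.1 = k * N + (p i).1 ∧ q.2 = k * N + (p i).2 + a ∧ a ≤ N) ∨
     (q.1 = k * N + (p i).1 - G ∧ q.2 = k * N + (p i).2 + G + a ∧ i + 1 = n ∧ a ≤ N ∧
       (k = -1 → a ≤ N - G)))}

theorem finite_freeCells (n : ℕ) (p : ℕ → Cell) (G N B : ℕ) : (freeCells n p G N B).Finite := by
  have : (⋃ k ∈ Set.Icc (-B : ℤ) B, ⋃ i ∈ Set.Iio n, ⋃ a ∈ Set.Icc (0 : ℤ) (N + G),
      ({(k * N + (p i).1 - a, k * N + (p i).2), (k * N + (p i).1 - G - a, k * N + (p i).2 + G),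
        (k * N + (p i).1, k * N + (p i).2 + a),
        (k * N + (p i).1 - G, k * N + (p i).2 + G + a)} : Set Cell)).Finite :=
    (Set.finite_Icc _ _).biUnion fun k _ => (Set.finite_Iio n).biUnion fun i _ =>
      (Set.finite_Icc _ _).biUnion fun a _ => Set.toFinite _
  refine this.subset ?_
  rintro ⟨x, y⟩ ⟨k, hk, i, hi, a, ha, h⟩
  simp only [Set.mem_iUnion]
  refine ⟨k, hk, i, hi, a, ha, ?_⟩
  simp only [Set.mem_insert_iff, Set.mem_singleton_iff, Prod.mk.injEq]
  tauto

/-- Makes the products `k * N` and `l * N` comparable linearly, so that `omega` can treat them as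
atoms. -/
theorem station_cases (k l : ℤ) (N : ℕ) :
    (k * N + 2 * N ≤ l * N ∧ k + 2 ≤ l) ∨ (k * N + N = l * N ∧ k + 1 = l) ∨
    (k * N = l * N ∧ k = l) ∨ (k * N = l * N + N ∧ k = l + 1) ∨
    (l * N + 2 * N ≤ k * N ∧ l + 2 ≤ k) := by
  have hN : (0 : ℤ) ≤ N := Int.natCast_nonneg N
  rcases lt_trichotomy (k + 1) l with h | rfl | h
  · have := mul_le_mul_of_nonneg_right (show k + 2 ≤ l by omega) hN
    rw [add_mul] at this
    omega
  · rw [add_mul, one_mul]; omega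
  · rcases lt_trichotomy k (l + 1) with h' | rfl | h'
    · obtain rfl : k = l := by omega
      omega
    · rw [add_mul, one_mul]; omega
    · have := mul_le_mul_of_nonneg_right (show l + 2 ≤ k by omega) hN
      rw [add_mul] at this
      omega

namespace Conveyor

variable {n u G N : ℕ} {p : ℕ → Cell}

/-- Cell `p 0` lies in the rightmost column, so no track of its station reaches beyond it. -/
theorem not_free_right_of_body (h : Conveyor n p u G N) (B : ℕ) (l : ℤ) {q : Cell}
    (h1 : q.1 = l * N + (p 0).1 + 1) (h2 : q.2 = l * N + (p 0).2) :
    q ∉ freeCells n p G N B := by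
  have hb := h.big
  rintro ⟨k, -, i, hi, a, ha, hq⟩
  have w1 := h.width i hi 0 (by omega)
  have w2 := h.width 0 (by omega) i hi
  have w3 := h.anti 0 i (by omega) hi
  rcases station_cases k l N with e | e | e | e | e <;> omega

theorem not_free_right_of_last (h : Conveyor n p u G N) (B : ℕ) (l : ℤ) {q : Cell} {t : ℕ}
    (ht : t + 1 = n) (h1 : q.1 = l * N + (p t).1 - G + 1) (h2 : q.2 = l * N + (p t).2 + G) :
    q ∉ freeCells n p G N B := by
  have hb := h.big
  rintro ⟨k, -, i, hi, a, ha, hq⟩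
  have w1 := h.width i hi t (by omega)
  have w2 := h.width t (by omega) i hi
  have w3 : i + 1 = n → (p i).1 = (p t).1 ∧ (p i).2 = (p t).2 := by
    intro h'
    obtain rfl : i = t := by omega
    exact ⟨rfl, rfl⟩
  rcases station_cases k l N with e | e | e | e | e <;> omega

/-- The horizontal tracks into the next station lie in rows of cells of `P`, hence not above the row
of `p u`. Were the last cell uniquely topmost, its track could open the cell above the body. -/
theorem not_free_above_body (h : Conveyor n p u G N) (B : ℕ) (l : ℤ) {q : Cell}
    (h1 : q.1 = l * N + (p u).1) (h2 : q.2 = l * N + N + (p u).2 + 1) :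
    q ∉ freeCells n p G N B := by
  have hb := h.big
  have hu := h.lt_last
  rintro ⟨k, -, i, hi, a, ha, hq⟩
  have w1 := h.width i hi u (by omega)
  have w2 := h.width u (by omega) i hi
  have w3 := h.top i hi
  rcases station_cases k l N with e | e | e | e | e <;> omega

theorem not_free_above_last (h : Conveyor n p u G N) (B : ℕ) (l : ℤ) {q : Cell} {t : ℕ}
    (ht : t + 1 = n) (h1 : q.1 = l * N + (p t).1 - G) (h2 : q.2 = l * N + N + (p t).2 + G + 1) :
    q ∉ freeCells n p G N B := by
  have hb := h.big
  rintro ⟨k, -, i, hi, a, ha, hq⟩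
  have w1 := h.width i hi t (by omega)
  have w2 := h.width t (by omega) i hi
  have w3 : i + 1 = n → (p i).1 = (p t).1 ∧ (p i).2 = (p t).2 := by
    intro h'
    obtain rfl : i = t := by omega
    exact ⟨rfl, rfl⟩
  rcases station_cases k l N with e | e | e | e | e <;> omega

/-- The vertical track of the last tile from station `-1` ends here, by the clause `a ≤ N - G`. The
body's horizontal tracks have length only `N` and start further right, since `p t` lies in the
leftmost column. -/
theorem not_free_above_last_staged (h : Conveyor n p u G N) (B : ℕ) {l : ℤ} (hl : l = -1)
    {q : Cell} {t : ℕ} (ht : t + 1 = n) (h1 : q.1 = l * N + (p t).1 - G)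
    (h2 : q.2 = l * N + N + (p t).2 + 1) :
    q ∉ freeCells n p G N B := by
  have hb := h.big
  rintro ⟨k, -, i, hi, a, ha, hq⟩
  have w1 := h.width i hi t (by omega)
  have w2 := h.width t (by omega) i hi
  have w4 := h.anti i t (by omega) (by omega)
  have w3 : i + 1 = n → (p i).1 = (p t).1 ∧ (p i).2 = (p t).2 := by
    intro h'
    obtain rfl : i = t := by omega
    exact ⟨rfl, rfl⟩
  rcases station_cases k l N with e | e | e | e | e <;> omega

end Conveyor

/-- The station that the group `j` has reached after `r` cycles. -/
def stationAt {D : ℕ} (r : ℕ) (j : Fin D) : ℤ := r - (j + 1)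

theorem stationAt_succ {D : ℕ} (r : ℕ) (j : Fin D) : stationAt (r + 1) j = stationAt r j + 1 := by
  unfold stationAt; push_cast; ring

theorem stationAt_bounds {D : ℕ} (r : ℕ) (j : Fin D) (hr : r ≤ D + 1) :
    -((D + 2 : ℕ) : ℤ) ≤ stationAt r j ∧ stationAt r j + 1 ≤ (D + 2 : ℕ) := by
  have := j.2
  unfold stationAt; push_cast; omega

theorem stationAt_injective {D : ℕ} (r : ℕ) {j j' : Fin D}
    (h : stationAt r j = stationAt r j') : j = j' := by
  unfold stationAt at h
  exact Fin.ext (by omega)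

/-- If the first `m` tiles of a group `j` are in position, then a property that spreads between
sticking tiles spreads over all of them. -/
theorem Sweep.spread_group {J : Type*} {m n : ℕ} {p : ℕ → Cell} (hp : Sweep m p) (hmn : m ≤ n)
    {f : J × Fin n → Cell} {j : J} {base : Cell}
    (hf : ∀ i (h : i < n), i < m → f (j, ⟨i, h⟩) = base + p i) {B : J × Fin n → Prop}
    (hB : ∀ i (h : i < n), i < m → ∀ i' (h' : i' < n), i' < m →
      gridGraph.Adj (f (j, ⟨i, h⟩)) (f (j, ⟨i', h'⟩)) → checker p i ≠ checker p i' →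
      B (j, ⟨i, h⟩) → B (j, ⟨i', h'⟩))
    {v : ℕ} (hv : v < m) (hBv : B (j, ⟨v, hv.trans_le hmn⟩)) {i : ℕ} (hi : i < m) :
    B (j, ⟨i, hi.trans_le hmn⟩) := by
  have := hp.spread (u := v) (i := i) (B := fun i => ∀ h : i < n, B (j, ⟨i, h⟩)) ?_ hv
    (fun _ => hBv) hi
  · exact this _
  · intro i hi i' hi' e hBi h'
    refine hB i (hi.trans_le hmn) hi i' h' hi' ?_ (checker_ne e) (hBi _)
    rw [hf i _ hi, hf i' _ hi']
    rw [adj_iff] at e ⊢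
    simp only [Prod.fst_add, Prod.snd_add]
    omega

/-! ### The movement steps of a cycle -/

namespace Conveyor

variable {n u G N D : ℕ} {p : ℕ → Cell}

/-- Columns weakly decrease along the sweep and the shift `2 * i` grows by two, so body tiles of a
group are at least two columns apart. The last tile is far above them, and `N` separates the
stations. -/
theorem apart_init (h : Conveyor n p u G N) {k k' : ℤ} {i i' : ℕ} (hi : i < n) (hi' : i' < n)
    (hne : k ≠ k' ∨ i ≠ i') :
    ¬ gridGraph.Adj (posInit n p G N k i) (posInit n p G N k' i') ∧
      posInit n p G N k i ≠ posInit n p G N k' i' := by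
  have hb := h.big
  have w1 := h.width i hi i' hi'
  have w2 := h.width i' hi' i hi
  have w3 := h.anti i i'
  have w4 := h.anti i' i
  rw [adj_iff, Ne, Prod.ext_iff]
  unfold posInit
  dsimp only
  rcases station_cases k k' N with e | e | e | e | e <;> split_ifs <;> omega

/-- All bodies form simultaneously: tile `i` halts at time `2 * i`, held by an earlier neighbour.
The last tiles already stand at their stops. -/
theorem rightInit (h : Conveyor n p u G N) {ε : ℤ} (hε : ε * ε = 1) (W : Workspace)
    (hW : ∀ q, mirror ε q ∉ W.obstacles ↔ q ∈ freeCells n p G N (D + 2)) :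
    Function.Injective (fun a : Fin D × Fin n => posRight n p G N (stationAt 0 a.1) a.2) ∧
    MovementStep W .right
      (tilesAt (fun a : Fin D × Fin n => checker p a.2)
        fun a => mirror ε (posInit n p G N (stationAt 0 a.1) a.2))
      (tilesAt (fun a : Fin D × Fin n => checker p a.2)
        fun a => mirror ε (posRight n p G N (stationAt 0 a.1) a.2)) := by
  have hb := h.big
  have neg : ∀ j : Fin D, stationAt 0 j < 0 := fun j => by unfold stationAt; push_cast; omega
  refine movementStep_mirror hε W _ hW .right (1, 0) (by simp [Dir.vec, mirror]) _ _ _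
    (fun a => if (a.2 : ℕ) + 1 = n then 0 else 2 * a.2) N ?_ ?_ ?_ ?_ ?_ ?_
  · rintro ⟨j, i⟩ ⟨j', i'⟩ e
    by_contra hne
    refine (h.apart_init i.2 i'.2 ?_).2 e
    by_contra! hc
    exact hne (Prod.ext (stationAt_injective 0 hc.1) (Fin.ext hc.2))
  · rintro ⟨j, i⟩
    have := i.2
    dsimp only
    split_ifs <;> omega
  · rintro ⟨j, i⟩
    have := neg j
    simp only [posRight, posInit, Prod.smul_mk, smul_eq_mul, mul_one, mul_zero, Prod.mk_add_mk,
      Prod.mk.injEq]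
    split_ifs <;> push_cast <;> omega
  · rintro ⟨j, i⟩ s hs hs0
    have hi := i.2
    have hk := stationAt_bounds 0 j (by omega)
    refine ⟨stationAt 0 j, by omega, i, hi, 2 * i - s, ?_⟩
    simp only [posInit, Prod.smul_mk, smul_eq_mul, mul_one, mul_zero, Prod.mk_add_mk] at hs ⊢
    split_ifs at hs ⊢ <;> omega
  · rintro s ⟨j, i⟩ ⟨j', i'⟩ hs hs'
    have w1 := h.width i i.2 i' i'.2
    have w2 := h.width i' i'.2 i i.2
    have w3 := h.anti i' i
    have w4 := h.inj i i.2 i' i'.2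
    have w5 := i.2
    have w6 := neg j'
    rw [Prod.ext_iff] at w4
    rw [adj_iff]
    simp only [posRight, posInit, Prod.smul_mk, smul_eq_mul, mul_one, mul_zero, Prod.mk_add_mk]
      at hs hs' ⊢
    rcases station_cases (stationAt 0 j) (stationAt 0 j') N with e | e | e | e | e <;>
      split_ifs at hs hs' ⊢ <;> omega
  · rintro B ⟨j, i, hi⟩ hob hbond
    have w6 := neg j
    dsimp only at hob hbond
    by_cases hl : i + 1 = n
    · refine hob _ le_rfl (h.not_free_right_of_last _ (stationAt 0 j) hl ?_ ?_)
      · simp only [posRight, hl, w6, and_self, if_true, Prod.fst_add]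
      · simp only [posRight, hl, w6, and_self, if_true, Prod.snd_add, add_zero]
    · have key : ∀ i' ≤ i, ∀ hi' : i' < n, B (j, ⟨i', hi'⟩) := by
        intro i'
        induction i' using Nat.strong_induction_on with
        | _ i' ih =>
          intro hle hi'
          rcases Nat.eq_zero_or_pos i' with rfl | h0
          · refine hob _ ?_ (h.not_free_right_of_body _ (stationAt 0 j) ?_ ?_)
            · dsimp only; split_ifs <;> omega
            · have : ¬ (0 + 1 = n) := by omega
              simp only [posRight, this, false_and, if_false, Prod.fst_add, sub_zero]
            · have : ¬ (0 + 1 = n) := by omega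
              simp only [posRight, this, false_and, if_false, Prod.snd_add, add_zero]
          · obtain ⟨b, hb, e⟩ := h.link i' h0 hi'
            refine hbond (j, ⟨b, by omega⟩) (j, ⟨i', hi'⟩) ?_ ?_ ?_ (checker_ne e)
              (ih b hb (by omega) _)
            · dsimp only; split_ifs <;> omega
            · dsimp only; split_ifs <;> omega
            · rw [adj_iff] at e ⊢
              unfold posRight
              dsimp only
              split_ifs <;> omega
      exact key i le_rfl hi

/-- Everything moves by `N`, except that the last tile leaving station `-1` stops `G` earlier, which
brings it into its proper row relative to the body. -/
theorem up (h : Conveyor n p u G N) {ε : ℤ} (hε : ε * ε = 1) (W : Workspace)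
    (hW : ∀ q, mirror ε q ∉ W.obstacles ↔ q ∈ freeCells n p G N (D + 2)) {d : Dir}
    (hd : d.vec = (0, ε)) {r : ℕ} (hr : r ≤ D)
    (hinj : Function.Injective
      (fun a : Fin D × Fin n => posRight n p G N (stationAt r a.1) a.2)) :
    Function.Injective (fun a : Fin D × Fin n => posUp n p G N (stationAt r a.1) a.2) ∧
    MovementStep W d
      (tilesAt (fun a : Fin D × Fin n => checker p a.2)
        fun a => mirror ε (posRight n p G N (stationAt r a.1) a.2))
      (tilesAt (fun a : Fin D × Fin n => checker p a.2)
        fun a => mirror ε (posUp n p G N (stationAt r a.1) a.2)) := by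
  have hb := h.big
  refine movementStep_mirror hε W _ hW d (0, 1) (by simp [hd, mirror]) _ _ _
    (fun a => if (a.2 : ℕ) + 1 = n ∧ stationAt r a.1 = -1 then N - G else N) N hinj ?_ ?_ ?_ ?_ ?_
  · rintro ⟨j, i⟩
    dsimp only
    split_ifs <;> omega
  · rintro ⟨j, i⟩
    simp only [posRight, posUp, Prod.smul_mk, smul_eq_mul, mul_one, mul_zero, Prod.mk_add_mk,
      Prod.mk.injEq]
    split_ifs <;> omega
  · rintro ⟨j, i⟩ s hs hs0
    have hi := i.2
    have hk := stationAt_bounds r j (by omega)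
    refine ⟨stationAt r j, by omega, i, hi, s, ?_⟩
    simp only [posRight, Prod.smul_mk, smul_eq_mul, mul_one, mul_zero, Prod.mk_add_mk] at hs ⊢
    split_ifs at hs ⊢ <;> omega
  · rintro s ⟨j, i⟩ ⟨j', i'⟩ hs hs'
    have w1 := h.width i i.2 i' i'.2
    have w2 := h.width i' i'.2 i i.2
    rw [adj_iff]
    simp only [posRight, posUp, Prod.smul_mk, smul_eq_mul, mul_one, mul_zero, Prod.mk_add_mk]
      at hs hs' ⊢
    rcases station_cases (stationAt r j) (stationAt r j') N with e | e | e | e | e <;>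
      split_ifs at hs hs' ⊢ <;> omega
  · rintro B ⟨j, i, hi⟩ hob hbond
    dsimp only at hob hbond
    by_cases hl : i + 1 = n ∧ stationAt r j < 0
    · by_cases hs : stationAt r j = -1
      · have : ¬ (stationAt r j < -1) := by omega
        refine hob _ le_rfl (h.not_free_above_last_staged _ hs hl.1 ?_ ?_)
        · simp only [posUp, hl, and_self, if_true, Prod.fst_add, add_zero]
        · simp only [posUp, this, and_false, if_false, Prod.snd_add, add_zero]
      · have : stationAt r j < -1 := by omega
        refine hob _ le_rfl (h.not_free_above_last _ (stationAt r j) hl.1 ?_ ?_)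
        · simp only [posUp, hl, and_self, if_true, Prod.fst_add, add_zero]
        · simp only [posUp, hl.1, this, and_self, if_true, Prod.snd_add]
    · have hu := h.lt_last
      -- The connected part to be stopped through tile `u`: the body before station `0`, the whole
      -- group from there on.
      obtain ⟨m, hm, hmn, hum, him⟩ : ∃ m, (∀ i' < m, ¬ (i' + 1 = n ∧ stationAt r j < 0)) ∧ m ≤ n ∧
          u < m ∧ i < m := by
        by_cases h0 : stationAt r j < 0
        · exact ⟨n - 1, fun i' hi' => by omega, by omega, by omega, by omega⟩
        · exact ⟨n, fun i' hi' => by omega, by omega, by omega, by omega⟩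
      have hT : ∀ a : Fin D × Fin n,
          (if (a.2 : ℕ) + 1 = n ∧ stationAt r a.1 = -1 then N - G else N) ≤
          (if i + 1 = n ∧ stationAt r j = -1 then N - G else N) := by
        intro a
        rw [if_neg (c := i + 1 = n ∧ _) (by omega)]
        split_ifs <;> omega
      refine (h.toSweep.mono hmn).spread_group (B := B) hmn
        (f := fun a : Fin D × Fin n => posUp n p G N (stationAt r a.1) a.2)
        (base := (stationAt r j * N, stationAt r j * N + N)) ?_
        (fun i₁ h₁ _ i₂ h₂ _ e => hbond _ _ (hT _) (hT _) e) hum ?_ him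
      · intro i' hi' him'
        have := hm i' him'
        unfold posUp
        refine Prod.ext ?_ ?_ <;> simp only [Prod.fst_add, Prod.snd_add] <;> split_ifs <;> omega
      · have hun : ¬ (u + 1 = n) := by omega
        refine hob _ (hT _) (h.not_free_above_body _ (stationAt r j) ?_ ?_)
        · simp only [posUp, hun, false_and, if_false, Prod.fst_add, sub_zero, add_zero]
        · simp only [posUp, hun, false_and, if_false, Prod.snd_add, add_zero]

/-- Everything moves by `N`, except that the last tile of the group entering station `0` goes on for
another `G`. It reaches its place from the left, after the body has halted. -/
theorem right (h : Conveyor n p u G N) {ε : ℤ} (hε : ε * ε = 1) (W : Workspace)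
    (hW : ∀ q, mirror ε q ∉ W.obstacles ↔ q ∈ freeCells n p G N (D + 2)) {r : ℕ} (hr : r ≤ D)
    (hinj : Function.Injective
      (fun a : Fin D × Fin n => posUp n p G N (stationAt r a.1) a.2)) :
    Function.Injective
      (fun a : Fin D × Fin n => posRight n p G N (stationAt (r + 1) a.1) a.2) ∧
    MovementStep W .right
      (tilesAt (fun a : Fin D × Fin n => checker p a.2)
        fun a => mirror ε (posUp n p G N (stationAt r a.1) a.2))
      (tilesAt (fun a : Fin D × Fin n => checker p a.2)
        fun a => mirror ε (posRight n p G N (stationAt (r + 1) a.1) a.2)) := by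
  have hb := h.big
  simp only [stationAt_succ]
  refine movementStep_mirror hε W _ hW .right (1, 0) (by simp [Dir.vec, mirror]) _ _ _
    (fun a => if (a.2 : ℕ) + 1 = n ∧ stationAt r a.1 = -1 then N + G else N) (N + G) hinj
    ?_ ?_ ?_ ?_ ?_
  · rintro ⟨j, i⟩
    dsimp only
    split_ifs <;> omega
  · rintro ⟨j, i⟩
    simp only [posRight, posUp, Prod.smul_mk, smul_eq_mul, mul_one, mul_zero, Prod.mk_add_mk,
      Prod.mk.injEq, add_mul, one_mul]
    split_ifs <;> omega
  · rintro ⟨j, i⟩ s hs hs0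
    have hi := i.2
    have hk := stationAt_bounds r j (by omega)
    refine ⟨stationAt r j + 1, by omega, i, hi,
      if (i : ℕ) + 1 = n ∧ stationAt r j = -1 then N + G - s else N - s, ?_⟩
    simp only [posUp, Prod.smul_mk, smul_eq_mul, mul_one, mul_zero, Prod.mk_add_mk, add_mul,
      one_mul] at hs ⊢
    split_ifs at hs ⊢ <;> omega
  · rintro s ⟨j, i⟩ ⟨j', i'⟩ hs hs'
    have w1 := h.width i i.2 i' i'.2
    have w2 := h.width i' i'.2 i i.2
    have w3 := h.anti i' i
    have w4 := h.inj i i.2 i' i'.2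
    have w5 := i'.2
    rw [Prod.ext_iff] at w4
    rw [adj_iff]
    simp only [posRight, posUp, Prod.smul_mk, smul_eq_mul, mul_one, mul_zero, Prod.mk_add_mk,
      add_mul, one_mul] at hs hs' ⊢
    rcases station_cases (stationAt r j) (stationAt r j') N with e | e | e | e | e <;>
      split_ifs at hs hs' ⊢ <;> omega
  · rintro B ⟨j, i, hi⟩ hob hbond
    dsimp only at hob hbond
    by_cases hl : i + 1 = n ∧ stationAt r j + 1 < 0
    · refine hob _ le_rfl (h.not_free_right_of_last _ (stationAt r j + 1) hl.1 ?_ ?_)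
      · simp only [posRight, hl, and_self, if_true, Prod.fst_add]
      · simp only [posRight, hl, and_self, if_true, Prod.snd_add, add_zero]
    · have hn := h.two_le
      -- For a body tile the last tile must be left out, since it may halt later; for an attached
      -- last tile the chain of bonds from tile `0` covers the whole group.
      obtain ⟨m, hm, hm', hmn, hum, him⟩ : ∃ m,
          (∀ i' < m, ¬ (i' + 1 = n ∧ stationAt r j + 1 < 0)) ∧
          (∀ i' < m, i' + 1 = n ∧ stationAt r j = -1 → i + 1 = n) ∧ m ≤ n ∧
          0 < m ∧ i < m := by
        by_cases h0 : i + 1 = n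
        · exact ⟨n, fun i' hi' => by omega, fun _ _ _ => h0, by omega, by omega, by omega⟩
        · exact ⟨n - 1, fun i' hi' => by omega, fun i' hi' => by omega, by omega, by omega,
            by omega⟩
      have hT : ∀ i' < m, (if i' + 1 = n ∧ stationAt r j = -1 then N + G else N) ≤
          (if i + 1 = n ∧ stationAt r j = -1 then N + G else N) := by
        intro i' hi'
        have := hm' i' hi'
        split_ifs <;> omega
      refine (h.toSweep.mono hmn).spread_group (B := B) hmn
        (f := fun a : Fin D × Fin n => posRight n p G N (stationAt r a.1 + 1) a.2)
        (base := ((stationAt r j + 1) * N, (stationAt r j + 1) * N)) ?_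
        (fun i₁ h₁ l₁ i₂ h₂ l₂ e => hbond _ _ (hT _ l₁) (hT _ l₂) e) hum ?_ him
      · intro i' hi' him'
        have := hm i' him'
        unfold posRight
        refine Prod.ext ?_ ?_ <;> simp only [Prod.fst_add, Prod.snd_add] <;> split_ifs <;> omega
      · have hun : ¬ (0 + 1 = n) := by omega
        refine hob _ (hT _ hum) (h.not_free_right_of_body _ (stationAt r j + 1) ?_ ?_)
        · simp only [posRight, hun, false_and, if_false, Prod.fst_add, sub_zero]
        · simp only [posRight, hun, false_and, if_false, Prod.snd_add, add_zero]

end Conveyor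

/-! ### Runs and the pipeline -/

theorem run_append {W : Workspace} {σ τ : List Dir} {c c' c'' : Config} (h : Run W σ c c')
    (h' : Run W τ c' c'') : Run W (σ ++ τ) c c'' := by
  induction σ generalizing c with
  | nil => obtain rfl := h; exact h'
  | cons d σ ih =>
    obtain ⟨c₁, h1, h2⟩ := h
    exact ⟨c₁, h1, ih h2⟩

theorem run_singleton {W : Workspace} {d : Dir} {c c' : Config} (h : MovementStep W d c c') :
    Run W [d] c c' :=
  ⟨c', h, rfl⟩

theorem encard_stationAt_nonneg {D j : ℕ} (hj : j ≤ D) :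
    {x : Fin D | 0 ≤ stationAt j x}.encard = j := by
  have : {x : Fin D | 0 ≤ stationAt j x} = Set.range (Fin.castLE hj) := by
    ext x
    simp only [Set.mem_ofPred_eq, Set.mem_range, stationAt]
    constructor
    · intro h
      exact ⟨⟨x, by omega⟩, rfl⟩
    · rintro ⟨y, rfl⟩
      have := y.2
      simp only [Fin.val_castLE]
      omega
  rw [this, ← Set.image_univ, (Fin.castLE_injective hj).encard_image, Set.encard_univ]
  simp

namespace Conveyor

variable {n u G N D : ℕ} {p : ℕ → Cell}

theorem copies_right (h : Conveyor n p u G N) {ε : ℤ} (hε : ε * ε = 1) (r : ℕ)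
    (hinj : Function.Injective
      (fun a : Fin D × Fin n => posRight n p G N (stationAt r a.1) a.2)) :
    copies (tilesAt (fun a : Fin D × Fin n => checker p a.2)
        fun a => mirror ε (posRight n p G N (stationAt r a.1) a.2))
      ((Finset.range n).image fun i => mirror ε (p i)) =
    (fun j : Fin D => mirror ε (stationAt r j * N, stationAt r j * N)) ''
      {j | 0 ≤ stationAt r j} := by
  have hb := h.big
  refine copies_tilesAt hε h.toSweep h.two_le (checker p) (fun i j => checker_ne) _ hinj
    (fun j => (stationAt r j * N, stationAt r j * N)) (fun j => 0 ≤ stationAt r j) ?_ ?_ _ rfl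
  · rintro ⟨j, i⟩ hj
    have hj' : ¬ (stationAt r j < 0) := not_lt.2 hj
    simp only [posRight, hj', and_false, if_false, sub_zero, add_zero]
    rfl
  · rintro ⟨j, i⟩ ⟨j', i'⟩ e
    have w1 := h.width i i.2 i' i'.2
    have w2 := h.width i' i'.2 i i.2
    have w3 : stationAt r j = stationAt r j' → j = j' := stationAt_injective r
    have w5 := i.2
    have w6 := i'.2
    have w7 : (i : ℕ) = i' → (p i).1 = (p i').1 ∧ (p i).2 = (p i').2 := fun h => by simp [h]
    rw [adj_iff] at e
    simp only [posRight] at e ⊢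
    rcases station_cases (stationAt r j) (stationAt r j') N with f | f | f | f | f
    · split_ifs at e <;> omega
    · split_ifs at e <;> omega
    · refine ⟨w3 f.2, ?_⟩
      split_ifs at e <;> omega
    · split_ifs at e <;> omega
    · split_ifs at e <;> omega

theorem copies_up (h : Conveyor n p u G N) {ε : ℤ} (hε : ε * ε = 1) (r : ℕ)
    (hinj : Function.Injective
      (fun a : Fin D × Fin n => posUp n p G N (stationAt r a.1) a.2)) :
    copies (tilesAt (fun a : Fin D × Fin n => checker p a.2)
        fun a => mirror ε (posUp n p G N (stationAt r a.1) a.2))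
      ((Finset.range n).image fun i => mirror ε (p i)) =
    (fun j : Fin D => mirror ε (stationAt r j * N, stationAt r j * N + N)) ''
      {j | 0 ≤ stationAt r j} := by
  have hb := h.big
  refine copies_tilesAt hε h.toSweep h.two_le (checker p) (fun i j => checker_ne) _ hinj
    (fun j => (stationAt r j * N, stationAt r j * N + N)) (fun j => 0 ≤ stationAt r j) ?_ ?_ _ rfl
  · rintro ⟨j, i⟩ hj
    have hj' : ¬ (stationAt r j < 0) := not_lt.2 hj
    have hj'' : ¬ (stationAt r j < -1) := by dsimp only at hj; omega
    simp only [posUp, hj', hj'', and_false, if_false, sub_zero, add_zero]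
    rfl
  · rintro ⟨j, i⟩ ⟨j', i'⟩ e
    have w1 := h.width i i.2 i' i'.2
    have w2 := h.width i' i'.2 i i.2
    have w3 : stationAt r j = stationAt r j' → j = j' := stationAt_injective r
    have w5 := i.2
    have w6 := i'.2
    have w7 : (i : ℕ) = i' → (p i).1 = (p i').1 ∧ (p i).2 = (p i').2 := fun h => by simp [h]
    rw [adj_iff] at e
    simp only [posUp] at e ⊢
    rcases station_cases (stationAt r j) (stationAt r j') N with f | f | f | f | f
    · split_ifs at e <;> omega
    · split_ifs at e <;> omega
    · refine ⟨w3 f.2, ?_⟩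
      split_ifs at e <;> omega
    · split_ifs at e <;> omega
    · split_ifs at e <;> omega

theorem pipelined (h : Conveyor n p u G N) {ε : ℤ} (hε : ε * ε = 1) {d : Dir}
    (hd : d.vec = (0, ε)) (D : ℕ) :
    Pipelined ((Finset.range n).image fun i => mirror ε (p i)) [.right, d] 1 D := by
  have hb := h.big
  have hn := h.two_le
  let W : Workspace :=
    { obstacles := {q | mirror ε q ∉ freeCells n p G N (D + 2)}
      finite_free := by
        have := (finite_freeCells n p G N (D + 2)).preimage
          ((mirror_injective hε).injOn (s := mirror ε ⁻¹' freeCells n p G N (D + 2)))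
        refine this.subset fun q hq => ?_
        simpa using hq }
  have hW : ∀ q, mirror ε q ∉ W.obstacles ↔ q ∈ freeCells n p G N (D + 2) := by
    intro q
    change ¬ (mirror ε (mirror ε q) ∉ _) ↔ _
    rw [mirror_mirror hε, not_not]
  set col := fun a : Fin D × Fin n => checker p a.2
  set c₀ := tilesAt col fun a => mirror ε (posInit n p G N (stationAt 0 a.1) a.2) with hc₀
  have run : ∀ r ≤ D, Function.Injective
      (fun a : Fin D × Fin n => posUp n p G N (stationAt r a.1) a.2) ∧
      Run W (List.replicate (1 + r) [.right, d]).flatten c₀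
        (tilesAt col fun a => mirror ε (posUp n p G N (stationAt r a.1) a.2)) := by
    intro r
    induction r with
    | zero =>
      intro _
      obtain ⟨i1, m1⟩ := h.rightInit (D := D) hε W hW
      obtain ⟨i2, m2⟩ := h.up hε W hW hd (Nat.zero_le D) i1
      exact ⟨i2, _, m1, run_singleton m2⟩
    | succ r ih =>
      intro hr
      obtain ⟨i0, h0⟩ := ih (by omega)
      obtain ⟨i1, m1⟩ := h.right hε W hW (by omega) i0
      obtain ⟨i2, m2⟩ := h.up hε W hW hd hr i1
      refine ⟨i2, ?_⟩
      rw [← add_assoc, List.replicate_succ', List.flatten_append]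
      exact run_append h0 ⟨_, m1, run_singleton m2⟩
  -- The output place is the end of the climb from station `0`; the next step to the right clears
  -- it.
  refine ⟨W, c₀, mirror ε (0, N), [.right], ⟨?_, ?_⟩, ⟨[d], rfl⟩, fun j hj => ?_⟩
  · rintro q hq
    obtain ⟨⟨j, i⟩, rfl⟩ := tilesAt_ne_none.1 hq
    rw [hW]
    have hi := i.2
    have hk := stationAt_bounds 0 j (by omega)
    refine ⟨stationAt 0 j, by omega, i, hi, if (i : ℕ) + 1 = n then 0 else 2 * i, ?_⟩
    simp only [posInit]
    split_ifs <;> omega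
  · rintro p' q' ⟨e, x, y, hx, hy, hxy⟩
    obtain ⟨⟨j, i⟩, rfl⟩ := tilesAt_ne_none.1 (hx ▸ Option.some_ne_none x : c₀ p' ≠ none)
    obtain ⟨⟨j', i'⟩, rfl⟩ := tilesAt_ne_none.1 (hy ▸ Option.some_ne_none y : c₀ q' ≠ none)
    by_cases hne : stationAt 0 j ≠ stationAt 0 j' ∨ (i : ℕ) ≠ i'
    · rw [mirror_adj hε] at e
      exact (h.apart_init i.2 i'.2 hne).1 e
    · push Not at hne
      obtain rfl := stationAt_injective 0 hne.1
      obtain rfl := Fin.ext hne.2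
      exact hxy (Option.some_injective _ (hx.symm.trans hy))
  · obtain ⟨i0, h0⟩ := run j hj
    obtain ⟨i1, m1⟩ := h.right hε W hW hj i0
    refine ⟨_, _, h0, ?_, ?_, run_singleton m1, ?_⟩
    · rw [h.copies_up hε j i0, Set.InjOn.encard_image, encard_stationAt_nonneg hj]
      intro x _ y _ hxy
      have := congrArg Prod.fst (mirror_injective hε hxy)
      exact stationAt_injective j (mul_right_cancel₀ (by omega) this)
    · intro hj1
      rw [h.copies_up hε j i0]
      have : stationAt j (⟨j - 1, by omega⟩ : Fin D) = 0 := by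
        simp only [stationAt]
        omega
      exact ⟨⟨j - 1, by omega⟩, this.ge, by simp [this]⟩
    · rw [h.copies_right hε (j + 1) i1]
      -- After a step to the right all copies have bases on the diagonal, while `(0, N)` is off it
      -- because `N > 0`.
      rintro ⟨x, -, hx⟩
      have := mirror_injective hε hx
      rw [Prod.ext_iff] at this
      dsimp only at this
      omega

end Conveyor

/-! ### Choice of parameters and conclusion -/

theorem Sweep.mirror {n : ℕ} {p : ℕ → Cell} (hp : Sweep n p) {ε : ℤ} (hε : ε * ε = 1) :
    Sweep n fun i => _root_.mirror ε (p i) :=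
  ⟨fun i hi j hj e => hp.inj i hi j hj (mirror_injective hε e), hp.anti, fun i h0 hi => by
    obtain ⟨j, hj, e⟩ := hp.link i h0 hi
    exact ⟨j, hj, (mirror_adj hε _ _).2 e⟩⟩

theorem exists_width (n : ℕ) (p : ℕ → Cell) : ∃ G : ℕ, ∀ i < n, ∀ j < n,
    (p i).1 - (p j).1 + 3 ≤ G ∧ (p i).2 - (p j).2 + 3 ≤ G := by
  refine ⟨2 * ∑ i ∈ Finset.range n, ((p i).1.natAbs + (p i).2.natAbs) + 3, fun i hi j hj => ?_⟩
  have h1 := Finset.single_le_sum (f := fun i => (p i).1.natAbs + (p i).2.natAbs)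
    (fun _ _ => Nat.zero_le _) (Finset.mem_range.2 hi)
  have h2 := Finset.single_le_sum (f := fun i => (p i).1.natAbs + (p i).2.natAbs)
    (fun _ _ => Nat.zero_le _) (Finset.mem_range.2 hj)
  omega

/-- The last of at least two cells is not both the unique topmost and the unique bottommost one. -/
theorem exists_extreme_before_last {n : ℕ} (hn : 2 ≤ n) (y : ℕ → ℤ) :
    ∃ ε : ℤ, (ε = 1 ∨ ε = -1) ∧ ∃ u, u + 1 < n ∧ ∀ i < n, ε * y i ≤ ε * y u := by
  have hne : (Finset.range (n - 1)).Nonempty := ⟨0, Finset.mem_range.2 (by omega)⟩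
  obtain ⟨u, hu, hmax⟩ := Finset.exists_max_image _ y hne
  obtain ⟨v, hv, hmin⟩ := Finset.exists_min_image _ y hne
  rw [Finset.mem_range] at hu hv
  have hvu := hmax v (Finset.mem_range.2 hv)
  rcases le_or_gt (y (n - 1)) (y u) with h | h
  · refine ⟨1, Or.inl rfl, u, by omega, fun i hi => ?_⟩
    rcases Nat.lt_or_ge i (n - 1) with hi' | hi'
    · have := hmax i (Finset.mem_range.2 hi')
      omega
    · obtain rfl : i = n - 1 := by omega
      omega
  · refine ⟨-1, Or.inr rfl, v, by omega, fun i hi => ?_⟩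
    rcases Nat.lt_or_ge i (n - 1) with hi' | hi'
    · have := hmin i (Finset.mem_range.2 hi')
      omega
    · obtain rfl : i = n - 1 := by omega
      omega

/-- Two movement steps per copy suffice for every `x`-monotone polyomino with at least two cells. -/
theorem TiltAssembly.IsXMonotone.exists_pipeline {P : Finset Cell} (hP : IsXMonotone P)
    (hcard : 2 ≤ P.card) : ∃ d : Dir, ∀ D, Pipelined P [.right, d] 1 D := by
  obtain ⟨p, hp, hpP⟩ := hP.exists_sweep (by omega)
  obtain ⟨ε, hε', u, hu, htop⟩ := exists_extreme_before_last hcard fun i => (p i).2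
  have hε : ε * ε = 1 := by rcases hε' with rfl | rfl <;> rfl
  obtain ⟨G, hG⟩ := exists_width P.card fun i => mirror ε (p i)
  have C : Conveyor P.card (fun i => mirror ε (p i)) u G (4 * G + 2 * P.card) :=
    { hp.mirror hε with
      two_le := hcard
      lt_last := hu
      top := htop
      width := hG
      big := le_rfl }
  obtain ⟨d, hd⟩ : ∃ d : Dir, d.vec = (0, ε) := by
    rcases hε' with rfl | rfl
    exacts [⟨.up, rfl⟩, ⟨.down, rfl⟩]
  refine ⟨d, fun D => ?_⟩
  have := C.pipelined hε hd D
  simp only [mirror_mirror hε] at this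
  rwa [hpP] at this

theorem one_le_logDecomp {P : Finset Cell} (hd : 0 < decompNumber P) : 1 ≤ logDecomp P := by
  refine Nat.one_le_iff_ne_zero.2 (Nat.pos_iff_ne_zero.1 (Nat.ceil_pos.2 ?_))
  refine Real.logb_pos one_lt_two ?_
  have : (0 : ℝ) < decompNumber P := Nat.cast_pos.2 hd
  linarith

theorem TiltAssembly.Pipelined.assembledWithin {P : Finset Cell} {cyc : List Dir} {m : ℕ}
    (h : Pipelined P cyc m 1) : AssembledWithin P ((m + 1) * cyc.length) := by
  obtain ⟨W, c₀, v, τ, h0, -, hj⟩ := h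
  obtain ⟨c, -, hrun, -, hv, -⟩ := hj 1 le_rfl
  exact ⟨W, c₀, c, _, h0, by simp, hrun, v, hv le_rfl⟩

theorem TiltAssembly.AssembledWithin.mono {P : Finset Cell} {k l : ℕ} (h : AssembledWithin P k)
    (hkl : k ≤ l) : AssembledWithin P l := by
  obtain ⟨W, c₀, c, σ, h0, hσ, h⟩ := h
  exact ⟨W, c₀, c, σ, h0, hσ.trans hkl, h⟩

theorem mainTheorem2 :
    ∃ C : ℕ, ∀ P : Finset Cell, IsXMonotone P → 0 < decompNumber P →
      AssembledWithin P (C * logDecomp P) ∧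
      ∃ (cyc : List Dir) (m : ℕ), cyc.length ≤ C ∧ m ≤ C * logDecomp P ∧
        ∀ D : ℕ, Pipelined P cyc m D ∧
          (List.replicate (m + D) cyc).flatten.length ≤ C * (logDecomp P + D) := by
  -- The first copy takes two cycles of two steps, hence `4`; `1 ≤ logDecomp P` absorbs the start-up
  -- cycle.
  refine ⟨4, fun P hP hd => ?_⟩
  have hL := one_le_logDecomp hd
  obtain ⟨d, h⟩ := hP.exists_pipeline (hP.two_le_card hd)
  refine ⟨(h 1).assembledWithin.mono (by simp; omega), [.right, d], 1, by simp, by omega,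
    fun D => ⟨h D, ?_⟩⟩
  simp
  omega
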